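/- For a finite set $S\subset\mathbb{R}^d$ (Euclidean metric) let $R(S)$ be the Vietoris–Rips complex whose faces are the subsets of $S$ of diameter at most $1$. For a field $\mathbf{k}$ let $\tilde\beta_p(R(S);\mathbf{k})=\dim_{\mathbf{k}}\tilde H_p(R(S);\mathbf{k})$ be its $p$-th reduced simplicial Betti number, and put $$M_{p,d}(n):=\max\{\tilde\beta_p(R(S);\mathbf{k}) : S\subset\mathbb{R}^d,\ |S|\le n\}.$$ Theorem. For every integer $p>0$ there is a real constant $C_p>0$, depending only on $p$, such that for every integer $d\ge 5$ there is an $N$ (independent of the field) such that for every field $\mathbf{k}$ and all $n\ge N$, $$M_{p,d}(n)\ \ge\ C_p\, n^{p/2+1/2}.$$ -/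

import Mathlib

namespace Rips

noncomputable section

open Classical in
/-- The simplicial boundary operator on formal `k`-linear combinations of finite vertex sets,
oriented by a strict total order `r` on the vertices:
if `F = {v₀ < v₁ < ⋯ < vₘ}` then `∂ F = ∑ᵢ (-1)ⁱ (F \ {vᵢ})`.
In particular `∂ {v} = ∅` (the augmentation of the reduced complex) and `∂ ∅ = 0`. -/
def boundary (k : Type*) [Field k] {V : Type*} (r : V → V → Prop) :
    (Finset V →₀ k) →ₗ[k] (Finset V →₀ k) :=
  Finsupp.linearCombination k fun F : Finset V =>
    ∑ v ∈ F, Finsupp.single (F.erase v) ((-1 : k) ^ (F.filter fun u => r u v).card)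

/-- The augmented chains of `K` on faces with exactly `m` vertices, i.e. in dimension `m - 1`.
Faces in `PreAbstractSimplicialComplex` are nonempty by convention,
so the empty face (dimension `-1`) is added here. -/
def chains (k : Type*) [Field k] {V : Type*} (K : PreAbstractSimplicialComplex V) (m : ℕ) :
    Submodule k (Finset V →₀ k) :=
  Finsupp.supported k k {F | (F = ∅ ∨ F ∈ K.faces) ∧ F.card = m}

/-- The `p`-dimensional reduced cycles of `K`. -/
def cycles (k : Type*) [Field k] {V : Type*} (r : V → V → Prop)
    (K : PreAbstractSimplicialComplex V) (p : ℕ) : Submodule k (Finset V →₀ k) :=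
  chains k K (p + 1) ⊓ LinearMap.ker (boundary k r)

/-- The `p`-dimensional boundaries of `K`. -/
def boundaries (k : Type*) [Field k] {V : Type*} (r : V → V → Prop)
    (K : PreAbstractSimplicialComplex V) (p : ℕ) : Submodule k (Finset V →₀ k) :=
  (chains k K (p + 2)).map (boundary k r)

/-- The quotient `Z / (B ∩ Z)` of subspaces of a vector space; it is used for `B ≤ Z`. -/
abbrev subquotient {k A : Type*} [Field k] [AddCommGroup A] [Module k A]
    (Z B : Submodule k A) : Type _ :=
  Z ⧸ B.submoduleOf Z

/-- The reduced simplicial homology `H̃_p(K; k)`: cycles modulo boundaries, the simplices being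
oriented by the strict total order `r` on the vertices. -/
abbrev reducedHomology (k : Type*) [Field k] {V : Type*} (r : V → V → Prop)
    (K : PreAbstractSimplicialComplex V) (p : ℕ) : Type _ :=
  subquotient (cycles k r K p) (boundaries k r K p)

/-- The reduced Betti number `β̃_p(K; k) = dim_k H̃_p(K; k)` of a complex with finitely many faces.
The simplices are oriented by some total order on the vertices; the choice is immaterial, see
`reducedBetti_eq_finrank`. -/
def reducedBetti (k : Type*) [Field k] {V : Type*}
    (K : PreAbstractSimplicialComplex V) (p : ℕ) : ℕ :=
  Module.finrank k (reducedHomology k (WellOrderingRel : V → V → Prop) K p)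

/-- The Vietoris–Rips complex `R^ε(S)`: the faces are the (nonempty) subsets of the finite set `S`
of diameter at most `ε`. -/
def ripsComplex {E : Type*} [MetricSpace E] (ε : ℝ) (S : Finset E) :
    PreAbstractSimplicialComplex E where
  faces := {F | F.Nonempty ∧ F ⊆ S ∧ Metric.diam (F : Set E) ≤ ε}
  isRelLowerSet_faces := by
    rintro F ⟨hF, hFS, hd⟩
    refine ⟨hF, fun G hGF hG => ⟨hG, ?_, ?_⟩⟩
    · exact subset_trans hGF hFS
    · exact (Metric.diam_mono (Finset.coe_subset.mpr hGF) F.finite_toSet.isBounded).trans hd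

/-- `M_{p,d}(n)`: the maximum of `β̃_p(R(S); k)` over all `S ⊆ ℝ^d` with at most `n` points, where
`R(S) = R^1(S)`. The maximum exists, see `isGreatest_maxBetti`. -/
def maxBetti (k : Type*) [Field k] (p d n : ℕ) : ℕ :=
  sSup {b | ∃ S : Finset (EuclideanSpace ℝ (Fin d)),
    S.card ≤ n ∧ reducedBetti k (ripsComplex 1 S) p = b}

/-! Sanity facts: `∂ ∘ ∂ = 0`, independence of the order, and existence of the maximum. -/

section Facts

variable {k : Type*} [Field k] {V : Type*}

open Classical in
theorem boundary_single (r : V → V → Prop) (F : Finset V) (c : k) :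
    boundary k r (Finsupp.single F c) =
      ∑ v ∈ F, Finsupp.single (F.erase v) (c * (-1 : k) ^ (F.filter fun u => r u v).card) := by
  simp [boundary, Finsupp.linearCombination_single, Finset.smul_sum]

open Classical in
theorem card_filter_erase (r : V → V → Prop) (F : Finset V) {v w : V} (hv : v ∈ F) :
    (F.filter fun u => r u w).card =
      ((F.erase v).filter fun u => r u w).card + if r v w then 1 else 0 := by
  conv_lhs => rw [← Finset.insert_erase hv]
  rw [Finset.filter_insert]
  split_ifs with h
  · rw [Finset.card_insert_of_notMem (by simp)]
  · simp

theorem boundary_boundary (r : V → V → Prop) [IsStrictTotalOrder V r] (x : Finset V →₀ k) :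
    boundary k r (boundary k r x) = 0 := by
  classical
  induction x using Finsupp.induction_linear with
  | zero => simp
  | add f g hf hg => simp [hf, hg]
  | single F c =>
    rw [boundary_single, map_sum]
    simp_rw [boundary_single]
    rw [Finset.sum_sigma']
    refine Finset.sum_involution (fun a _ => ⟨a.2, a.1⟩) ?_ ?_ ?_ ?_
    · rintro ⟨v, w⟩ h
      simp only [Finset.mem_sigma, Finset.mem_erase] at h
      obtain ⟨hv, hwv, hw⟩ := h
      dsimp only
      rw [Finset.erase_right_comm, ← Finsupp.single_add]
      refine (congrArg (Finsupp.single _) ?_).trans (Finsupp.single_zero _)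
      rw [card_filter_erase r F (v := w) (w := v) hw, card_filter_erase r F (v := v) (w := w) hv]
      rcases trichotomous_of r v w with h | h | h
      · rw [if_pos h, if_neg (asymm h)]; ring
      · exact absurd h.symm hwv
      · rw [if_pos h, if_neg (asymm h)]; ring
    · rintro ⟨v, w⟩ h _ he
      simp only [Finset.mem_sigma, Finset.mem_erase] at h
      simp only [Sigma.mk.injEq] at he
      exact h.2.1 he.1
    · rintro ⟨v, w⟩ h
      simp only [Finset.mem_sigma, Finset.mem_erase] at h ⊢
      exact ⟨h.2.2, fun e => h.2.1 e.symm, h.1⟩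
    · rintro ⟨v, w⟩ h
      rfl

theorem boundary_mem_chains (r : V → V → Prop) (K : PreAbstractSimplicialComplex V) (m : ℕ)
    {x : Finset V →₀ k} (hx : x ∈ chains k K (m + 1)) : boundary k r x ∈ chains k K m := by
  classical
  rw [boundary, Finsupp.linearCombination_apply]
  refine Submodule.sum_mem _ fun F hF => Submodule.smul_mem _ _ (Submodule.sum_mem _ fun v hv => ?_)
  obtain ⟨hF1, hF2⟩ := (Finsupp.mem_supported k x).mp hx hF
  refine Finsupp.single_mem_supported k _ ⟨?_, ?_⟩
  · rcases (F.erase v).eq_empty_or_nonempty with h | h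
    · exact Or.inl h
    · refine Or.inr ((K.isRelLowerSet_faces (hF1.resolve_left ?_)).2 (Finset.erase_subset v F) h)
      rintro rfl
      simp at hv
  · rw [Finset.card_erase_of_mem hv, hF2]; rfl

theorem boundaries_le_cycles (r : V → V → Prop) [IsStrictTotalOrder V r]
    (K : PreAbstractSimplicialComplex V) (p : ℕ) : boundaries k r K p ≤ cycles k r K p := by
  rintro _ ⟨x, hx, rfl⟩
  exact ⟨boundary_mem_chains r K (p + 1) hx, boundary_boundary r x⟩

open Classical in
/-- The sign relating the orientations of a simplex by two total orders. -/
def orderSign (k : Type*) [Field k] (r s : V → V → Prop) (F : Finset V) : k :=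
  (-1 : k) ^ ((F ×ˢ F).filter fun a => r a.1 a.2 ∧ s a.2 a.1).card

theorem orderSign_mul_self (r s : V → V → Prop) (F : Finset V) :
    orderSign k r s F * orderSign k r s F = 1 := by
  rw [orderSign, ← pow_add, ← two_mul, pow_mul]; simp

/-- Reorientation of simplices. -/
def reorient (k : Type*) [Field k] (r s : V → V → Prop) :
    (Finset V →₀ k) →ₗ[k] (Finset V →₀ k) :=
  Finsupp.linearCombination k fun F : Finset V => Finsupp.single F (orderSign k r s F)

theorem reorient_single (r s : V → V → Prop) (F : Finset V) (c : k) :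
    reorient k r s (Finsupp.single F c) = Finsupp.single F (c * orderSign k r s F) := by
  simp [reorient, Finsupp.linearCombination_single]

theorem reorient_reorient (r s : V → V → Prop) (x : Finset V →₀ k) :
    reorient k r s (reorient k r s x) = x := by
  induction x using Finsupp.induction_linear with
  | zero => simp
  | add f g hf hg => simp [hf, hg]
  | single F c => rw [reorient_single, reorient_single, mul_assoc, orderSign_mul_self, mul_one]

theorem reorient_mem_chains (r s : V → V → Prop) (K : PreAbstractSimplicialComplex V) (m : ℕ)
    {x : Finset V →₀ k} (hx : x ∈ chains k K m) : reorient k r s x ∈ chains k K m := by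
  rw [reorient, Finsupp.linearCombination_apply]
  exact Submodule.sum_mem _ fun F hF => Submodule.smul_mem _ _
    (Finsupp.single_mem_supported k _ ((Finsupp.mem_supported k x).mp hx hF))

open Classical in
theorem orderSign_erase (r s : V → V → Prop) [IsStrictTotalOrder V r] [IsStrictTotalOrder V s]
    (F : Finset V) {v : V} (hv : v ∈ F) :
    orderSign k r s F * (-1 : k) ^ (F.filter fun u => s u v).card =
      (-1 : k) ^ (F.filter fun u => r u v).card * orderSign k r s (F.erase v) := by
  have key : ((F ×ˢ F).filter fun a => r a.1 a.2 ∧ s a.2 a.1).card =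
      (((F.erase v) ×ˢ (F.erase v)).filter fun a => r a.1 a.2 ∧ s a.2 a.1).card +
        ((F.filter fun u => r u v ∧ s v u).card + (F.filter fun u => r v u ∧ s u v).card) := by
    have e : (F ×ˢ F).filter (fun a => r a.1 a.2 ∧ s a.2 a.1) =
        ((F.erase v) ×ˢ (F.erase v)).filter (fun a => r a.1 a.2 ∧ s a.2 a.1) ∪
          ((F.filter fun u => r u v ∧ s v u).image (fun u => (u, v)) ∪
            (F.filter fun u => r v u ∧ s u v).image (fun u => (v, u))) := by
      ext ⟨a, b⟩
      simp only [Finset.mem_filter, Finset.mem_product, Finset.mem_union, Finset.mem_erase,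
        Finset.mem_image, Prod.mk.injEq]
      constructor
      · rintro ⟨⟨ha, hb⟩, h⟩
        by_cases hb' : b = v
        · subst hb'; exact Or.inr (Or.inl ⟨a, ⟨ha, h⟩, rfl, rfl⟩)
        · by_cases ha' : a = v
          · subst ha'; exact Or.inr (Or.inr ⟨b, ⟨hb, h⟩, rfl, rfl⟩)
          · exact Or.inl ⟨⟨⟨ha', ha⟩, hb', hb⟩, h⟩
      · rintro (⟨⟨⟨_, ha⟩, _, hb⟩, h⟩ | ⟨u, ⟨hu, h⟩, rfl, rfl⟩ | ⟨u, ⟨hu, h⟩, rfl, rfl⟩)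
        · exact ⟨⟨ha, hb⟩, h⟩
        · exact ⟨⟨hu, hv⟩, h⟩
        · exact ⟨⟨hv, hu⟩, h⟩
    rw [e, Finset.card_union_of_disjoint, Finset.card_union_of_disjoint,
      Finset.card_image_of_injective _ (fun a b h => (Prod.mk.inj h).1),
      Finset.card_image_of_injective _ (fun a b h => (Prod.mk.inj h).2)]
    · rw [Finset.disjoint_left]
      rintro ⟨a, b⟩ h1 h2
      simp only [Finset.mem_filter, Finset.mem_image, Prod.mk.injEq] at h1 h2
      obtain ⟨u, ⟨_, h, _⟩, rfl, rfl⟩ := h1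
      obtain ⟨w, ⟨_, h', _⟩, rfl, rfl⟩ := h2
      exact irrefl _ h
    · rw [Finset.disjoint_left]
      rintro ⟨a, b⟩ h1 h2
      simp only [Finset.mem_filter, Finset.mem_product, Finset.mem_erase, Finset.mem_union,
        Finset.mem_image, Prod.mk.injEq] at h1 h2
      rcases h2 with ⟨u, _, _, h⟩ | ⟨u, _, h, _⟩
      · exact h1.1.2.1 h.symm
      · exact h1.1.1.1 h.symm
  have split1 : (F.filter fun u => r u v).card =
      (F.filter fun u => r u v ∧ s v u).card + (F.filter fun u => r u v ∧ s u v).card := by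
    rw [← Finset.card_union_of_disjoint]
    · congr 1
      ext u
      simp only [Finset.mem_filter, Finset.mem_union]
      constructor
      · rintro ⟨hu, h⟩
        rcases trichotomous_of s u v with h' | h' | h'
        · exact Or.inr ⟨hu, h, h'⟩
        · subst h'; exact absurd h (irrefl _)
        · exact Or.inl ⟨hu, h, h'⟩
      · rintro (⟨hu, h, _⟩ | ⟨hu, h, _⟩) <;> exact ⟨hu, h⟩
    · rw [Finset.disjoint_left]
      intro u h1 h2
      exact asymm (Finset.mem_filter.mp h1).2.2 (Finset.mem_filter.mp h2).2.2
  have split2 : (F.filter fun u => s u v).card =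
      (F.filter fun u => r v u ∧ s u v).card + (F.filter fun u => r u v ∧ s u v).card := by
    rw [← Finset.card_union_of_disjoint]
    · congr 1
      ext u
      simp only [Finset.mem_filter, Finset.mem_union]
      constructor
      · rintro ⟨hu, h⟩
        rcases trichotomous_of r u v with h' | h' | h'
        · exact Or.inr ⟨hu, h', h⟩
        · subst h'; exact absurd h (irrefl _)
        · exact Or.inl ⟨hu, h', h⟩
      · rintro (⟨hu, _, h⟩ | ⟨hu, _, h⟩) <;> exact ⟨hu, h⟩
    · rw [Finset.disjoint_left]
      intro u h1 h2
      exact asymm (Finset.mem_filter.mp h1).2.1 (Finset.mem_filter.mp h2).2.1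
  rw [orderSign, orderSign, key, split1, split2]
  set A := (((F.erase v) ×ˢ (F.erase v)).filter fun a => r a.1 a.2 ∧ s a.2 a.1).card
  set B := (F.filter fun u => r u v ∧ s v u).card
  set C := (F.filter fun u => r v u ∧ s u v).card
  set D := (F.filter fun u => r u v ∧ s u v).card
  have hC : (-1 : k) ^ C * (-1 : k) ^ C = 1 := by
    rw [← pow_add, ← two_mul, pow_mul]; simp
  simp only [pow_add]
  linear_combination ((-1 : k) ^ A * (-1 : k) ^ B * (-1 : k) ^ D) * hC

theorem boundary_reorient (r s : V → V → Prop) [IsStrictTotalOrder V r] [IsStrictTotalOrder V s]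
    (x : Finset V →₀ k) :
    boundary k s (reorient k r s x) = reorient k r s (boundary k r x) := by
  classical
  induction x using Finsupp.induction_linear with
  | zero => simp
  | add f g hf hg => simp [hf, hg]
  | single F c =>
    rw [reorient_single, boundary_single, boundary_single, map_sum]
    refine Finset.sum_congr rfl fun v hv => ?_
    rw [reorient_single, mul_assoc, mul_assoc, orderSign_erase r s F hv]

/-- The reduced homology groups for two orders on the vertices are isomorphic. -/
theorem nonempty_reducedHomology_equiv (r s : V → V → Prop) [IsStrictTotalOrder V r]
    [IsStrictTotalOrder V s] (K : PreAbstractSimplicialComplex V) (p : ℕ) :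
    Nonempty (reducedHomology k r K p ≃ₗ[k] reducedHomology k s K p) := by
  let e : (Finset V →₀ k) ≃ₗ[k] (Finset V →₀ k) :=
    LinearEquiv.ofInvolutive (reorient k r s) (reorient_reorient r s)
  have hinv : ∀ x, reorient k r s (reorient k r s x) = x := reorient_reorient r s
  have hcomm' : ∀ x, boundary k r (reorient k r s x) = reorient k r s (boundary k s x) := by
    intro x
    rw [← hinv (boundary k r (reorient k r s x)), ← boundary_reorient, hinv]
  have hZ : (cycles k r K p).map (e : (Finset V →₀ k) →ₗ[k] (Finset V →₀ k)) = cycles k s K p := by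
    ext x
    constructor
    · rintro ⟨y, ⟨hy1, hy2⟩, rfl⟩
      refine ⟨reorient_mem_chains r s K _ hy1, ?_⟩
      change boundary k s (reorient k r s y) = 0
      rw [boundary_reorient, LinearMap.mem_ker.mp hy2, map_zero]
    · rintro ⟨hx1, hx2⟩
      refine ⟨reorient k r s x, ⟨reorient_mem_chains r s K _ hx1, ?_⟩, hinv x⟩
      change boundary k r (reorient k r s x) = 0
      rw [hcomm', LinearMap.mem_ker.mp hx2, map_zero]
  have hB : ∀ x, reorient k r s x ∈ boundaries k s K p ↔ x ∈ boundaries k r K p := by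
    intro x
    constructor
    · rintro ⟨y, hy, h⟩
      refine ⟨reorient k r s y, reorient_mem_chains r s K _ hy, ?_⟩
      rw [hcomm', h, hinv]
    · rintro ⟨y, hy, rfl⟩
      exact ⟨reorient k r s y, reorient_mem_chains r s K _ hy, boundary_reorient r s y⟩
  let f : cycles k r K p ≃ₗ[k] cycles k s K p := e.ofSubmodules _ _ hZ
  refine ⟨Submodule.Quotient.equiv _ _ f ?_⟩
  ext x
  constructor
  · rintro ⟨y, hy, rfl⟩
    exact (hB y).mpr hy
  · intro hx
    refine ⟨f.symm x, ?_, f.apply_symm_apply x⟩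
    refine (hB _).mp ?_
    have : reorient k r s (f.symm x : Finset V →₀ k) = (x : Finset V →₀ k) :=
      congrArg Subtype.val (f.apply_symm_apply x)
    exact (congrArg (· ∈ boundaries k s K p) this).mpr hx

/-- The reduced Betti number can be computed with any total order on the vertices. -/
theorem reducedBetti_eq_finrank (r : V → V → Prop) [IsStrictTotalOrder V r]
    (K : PreAbstractSimplicialComplex V) (p : ℕ) :
    reducedBetti k K p = Module.finrank k (reducedHomology k r K p) := by
  have : IsStrictTotalOrder V WellOrderingRel := { }
  exact (nonempty_reducedHomology_equiv WellOrderingRel r K p).some.finrank_eq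

theorem reducedBetti_ripsComplex_le {E : Type*} [MetricSpace E] (ε : ℝ) (S : Finset E) (p : ℕ) :
    reducedBetti k (ripsComplex ε S) p ≤ S.card.choose (p + 1) := by
  classical
  have hsub : {F : Finset E | (F = ∅ ∨ F ∈ (ripsComplex ε S).faces) ∧ F.card = p + 1} ⊆
      (S.powersetCard (p + 1) : Set (Finset E)) := by
    rintro F ⟨hF | hF, hc⟩
    · simp [hF] at hc
    · exact Finset.mem_coe.mpr (Finset.mem_powersetCard.mpr ⟨hF.2.1, hc⟩)
  let T := Finsupp.supported k k (S.powersetCard (p + 1) : Set (Finset E))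
  have hle : cycles k WellOrderingRel (ripsComplex ε S) p ≤ T :=
    inf_le_left.trans (Finsupp.supported_mono hsub)
  let eT : T ≃ₗ[k] ((S.powersetCard (p + 1) : Set (Finset E)) →₀ k) :=
    Finsupp.supportedEquivFinsupp _
  have : Module.Finite k T := Module.Finite.equiv eT.symm
  have hT : Module.finrank k T = S.card.choose (p + 1) := by
    rw [eT.finrank_eq, Module.finrank_finsupp_self]
    simp
  have : Module.Finite k (cycles k WellOrderingRel (ripsComplex ε S) p) :=
    Submodule.finiteDimensional_of_le hle
  rw [← hT]
  exact (Submodule.finrank_quotient_le _).trans (Submodule.finrank_mono hle)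

/-- The maximum in the definition of `M_{p,d}(n)` is attained. -/
theorem isGreatest_maxBetti (k : Type*) [Field k] (p d n : ℕ) :
    IsGreatest {b | ∃ S : Finset (EuclideanSpace ℝ (Fin d)),
      S.card ≤ n ∧ reducedBetti k (ripsComplex 1 S) p = b} (maxBetti k p d n) := by
  have hbdd : BddAbove {b | ∃ S : Finset (EuclideanSpace ℝ (Fin d)),
      S.card ≤ n ∧ reducedBetti k (ripsComplex 1 S) p = b} := by
    refine ⟨n.choose (p + 1), ?_⟩
    rintro _ ⟨S, hS, rfl⟩
    exact (reducedBetti_ripsComplex_le 1 S p).trans (Nat.choose_le_choose _ hS)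
  exact ⟨Nat.sSup_mem ⟨_, ∅, by simp, rfl⟩ hbdd, fun b hb => le_csSup hbdd hb⟩

end Facts

end

end Rips

namespace Rips

noncomputable section

/-! Homology classes are detected by maximal faces. No chain one dimension up has a boundary with a
nonzero coefficient on a maximal face, so cycles `z α` and maximal faces `F β` with `z α (F β) ≠ 0`
exactly when `α = β` have independent classes (`FacetCycles.card_le_reducedBetti`). Only
nonvanishing of coefficients matters, which makes the argument uniform in the field.

Two blocks supply such families. A ladder consists of two simplices `x i`, `y i` joined only along
`L + 1` rungs; comparing each rung with rung `0` gives `L` circles. Joining with it multiplies the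
number of classes by `L`, raises the dimension by two and costs `2 (L + 1)` points
(`FacetCycles.joinLadder`). A grid consists of three simplices on points `a i j`, `b j l`, `c l i`,
adjacent across simplices exactly when the shared index agrees. The triangles `a i j, b j l, c l i`
are maximal, and each with nonzero indices lies on a sphere whose other triangles all have a vertex
with index `0`: so `3 (N + 1) ^ 2` points carry `N ^ 3` classes (`FacetCycles.grid`). Joins of
ladders settle odd `p`, and a grid joined with ladders settles even `p`. With `L = N ^ 2` both give
`N ^ (p + 1)` classes on `O(N ^ 2)` points.

Five dimensions realise everything at once (`exists_configuration`). The grid sits near an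
equilateral triangle of side `1` in a plane and the ladders near antipodal points of circles of
radius `1 / 2` in the orthogonal space. All pairs that must be adjacent regardless of indices are at
distance less than `1` in the limit and stay so under small perturbation; the remaining pairs are at
distance exactly `1`, and second-order terms decide. -/

open Classical in
/-- Left exterior multiplication of simplicial chains by a vertex. -/
def cone (k : Type*) [Field k] {V : Type*} (r : V → V → Prop) (v : V) :
    (Finset V →₀ k) →ₗ[k] (Finset V →₀ k) :=
  Finsupp.linearCombination k fun F : Finset V =>
    if v ∈ F then 0 else Finsupp.single (insert v F) ((-1 : k) ^ (F.filter fun u => r u v).card)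

/-! ### Exterior multiplication and clique chains -/

section Cone

variable {k : Type*} [Field k] {V : Type*}

open Classical in
theorem cone_single (r : V → V → Prop) (v : V) (F : Finset V) (c : k) :
    cone k r v (Finsupp.single F c) = if v ∈ F then 0 else
      Finsupp.single (insert v F) (c * (-1 : k) ^ (F.filter fun u => r u v).card) := by
  simp [cone, Finsupp.linearCombination_single]

open Classical in
theorem cone_apply (r : V → V → Prop) (v : V) (w : Finset V →₀ k) (F : Finset V) :
    cone k r v w F = if v ∈ F then
      w (F.erase v) * (-1 : k) ^ ((F.erase v).filter fun u => r u v).card else 0 := by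
  induction w using Finsupp.induction_linear with
  | zero => simp
  | add f g hf hg => rw [map_add, Finsupp.add_apply, hf, hg]; split_ifs <;> simp [add_mul]
  | single G c =>
    rw [cone_single]
    by_cases hG : v ∈ G
    · have : G ≠ F.erase v := by rintro rfl; simp at hG
      simp [hG, this]
    · by_cases hF : v ∈ F
      · by_cases h : G = F.erase v
        · subst h
          simp [hF]
        · have : insert v G ≠ F := by rintro rfl; simp [hG] at h
          simp [hG, hF, h, this]
      · have : insert v G ≠ F := by rintro rfl; simp at hF
        simp [hG, hF, this]

theorem cone_apply_of_notMem (r : V → V → Prop) {v : V} (w : Finset V →₀ k) {F : Finset V}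
    (h : v ∉ F) : cone k r v w F = 0 := by
  rw [cone_apply, if_neg h]

-- Multiplication by `v` matches faces containing `v` with faces avoiding it, up to sign, so
-- coefficients never cancel. All later evaluations need only nonvanishing, and the signs disappear
-- here.
open Classical in
theorem cone_apply_eq_zero_iff (r : V → V → Prop) {v : V} (w : Finset V →₀ k) {F : Finset V}
    (h : v ∈ F) : cone k r v w F = 0 ↔ w (F.erase v) = 0 := by
  rw [cone_apply, if_pos h]
  simp

theorem boundary_empty (r : V → V → Prop) (c : k) :
    boundary k r (Finsupp.single ∅ c) = 0 := by
  simp [boundary_single]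

/-- The Leibniz rule for `v ∧ w`. It needs no assumption that `v` avoids the faces of `w`: if `v ∈
F` the product is zero, and on the right only the term of `∂ F` that deletes `v` survives, restoring
`F`. -/
theorem boundary_cone (r : V → V → Prop) [IsStrictTotalOrder V r] (v : V)
    (w : Finset V →₀ k) : boundary k r (cone k r v w) = w - cone k r v (boundary k r w) := by
  classical
  induction w using Finsupp.induction_linear with
  | zero => simp
  | add f g hf hg => simp only [map_add, hf, hg]; abel
  | single F c =>
    have sq : ∀ n : ℕ, ((-1 : k) ^ n) * (-1) ^ n = 1 := fun n => by
      rw [← pow_add, ← two_mul, pow_mul]; simp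
    rw [cone_single, boundary_single, map_sum]
    simp_rw [cone_single]
    by_cases hv : v ∈ F
    · rw [if_pos hv, map_zero, Finset.sum_eq_single_of_mem v hv]
      · rw [if_neg (by simp), Finset.insert_erase hv, card_filter_erase r F hv,
          if_neg (irrefl v), add_zero, mul_assoc, sq, mul_one, sub_self]
      · intro w _ hwv
        rw [if_pos (Finset.mem_erase.mpr ⟨hwv.symm, hv⟩)]
    · rw [if_neg hv, boundary_single, Finset.sum_insert hv, Finset.erase_insert hv,
        card_filter_erase r (insert v F) (Finset.mem_insert_self v F), Finset.erase_insert hv,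
        if_neg (irrefl v), add_zero, mul_assoc, sq, mul_one, sub_eq_add_neg, ← Finset.sum_neg_distrib]
      congr 1
      refine Finset.sum_congr rfl fun w hw => ?_
      have hvw : v ≠ w := by rintro rfl; exact hv hw
      rw [if_neg (fun h => hv (Finset.mem_of_mem_erase h)),
        Finset.erase_insert_of_ne hvw, ← Finsupp.single_neg]
      congr 1
      rw [card_filter_erase r (insert v F) (Finset.mem_insert_self v F), Finset.erase_insert hv,
        card_filter_erase r F hw (w := v)]
      rcases trichotomous_of r v w with h | h | h
      · rw [if_pos h, if_neg (asymm h)]; ring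
      · exact absurd h hvw
      · rw [if_pos h, if_neg (asymm h)]; ring

/-- The chains on the cliques with `m` vertices in `U`, for the adjacency "at distance `≤ 1`". -/
def cliqueChains (k : Type*) [Field k] {E : Type*} [MetricSpace E] (U : Set E) (m : ℕ) :
    Submodule k (Finset E →₀ k) :=
  Finsupp.supported k k {F | (F : Set E) ⊆ U ∧ (∀ u ∈ F, ∀ v ∈ F, dist u v ≤ 1) ∧ F.card = m}

variable {E : Type*} [MetricSpace E]

theorem cliqueChains_mono {U U' : Set E} (h : U ⊆ U') (m : ℕ) :
    cliqueChains k U m ≤ cliqueChains k U' m :=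
  Finsupp.supported_mono fun _ hF => ⟨hF.1.trans h, hF.2⟩

theorem single_empty_mem_cliqueChains (U : Set E) (c : k) :
    Finsupp.single ∅ c ∈ cliqueChains k U 0 :=
  Finsupp.single_mem_supported k _ (by simp)

theorem cone_mem_cliqueChains (r : E → E → Prop) {U : Set E} {m : ℕ} {w : Finset E →₀ k}
    (hw : w ∈ cliqueChains k U m) {v : E} (hv : ∀ u ∈ U, dist v u ≤ 1) :
    cone k r v w ∈ cliqueChains k (insert v U) (m + 1) := by
  classical
  rw [cone, Finsupp.linearCombination_apply]
  refine Submodule.sum_mem _ fun F hF => Submodule.smul_mem _ _ ?_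
  obtain ⟨hU, hc, hm⟩ := (Finsupp.mem_supported k w).mp hw hF
  split_ifs with h
  · exact Submodule.zero_mem _
  · refine Finsupp.single_mem_supported k _ ⟨?_, ?_, ?_⟩
    · rw [Finset.coe_insert]; exact Set.insert_subset_insert hU
    · intro a ha b hb
      rcases Finset.mem_insert.mp ha with rfl | ha' <;> rcases Finset.mem_insert.mp hb with rfl | hb'
      · simp
      · exact hv _ (hU hb')
      · rw [dist_comm]; exact hv _ (hU ha')
      · exact hc _ ha' _ hb'
    · rw [Finset.card_insert_of_notMem h, hm]

theorem mem_ripsComplex_faces {S F : Finset E} :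
    F ∈ (ripsComplex 1 S).faces ↔ F.Nonempty ∧ F ⊆ S ∧ ∀ u ∈ F, ∀ v ∈ F, dist u v ≤ 1 := by
  refine and_congr_right fun _ => and_congr_right fun _ => ⟨fun h u hu v hv => ?_, fun h => ?_⟩
  · exact (Metric.dist_le_diam_of_mem F.finite_toSet.isBounded hu hv).trans h
  · exact Metric.diam_le_of_forall_dist_le zero_le_one fun u hu v hv => h u hu v hv

theorem cliqueChains_eq_chains (S : Finset E) (m : ℕ) :
    cliqueChains k (S : Set E) m = chains k (ripsComplex 1 S) m := by
  rw [cliqueChains, chains]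
  congr 1
  ext F
  simp only [Set.mem_ofPred_eq, mem_ripsComplex_faces, Finset.coe_subset]
  rcases F.eq_empty_or_nonempty with rfl | h
  · simp
  · simp [h, h.ne_empty, and_assoc]

end Cone

/-! ### Cycles dual to maximal faces -/

/-- Cycles of the Rips complex of `S` on `m` vertices per simplex, dual to a family of maximal
faces. -/
structure FacetCycles (k : Type*) [Field k] {E : Type*} [MetricSpace E] (r : E → E → Prop)
    (S : Finset E) (m : ℕ) (ι : Type*) where
  cycle : ι → Finset E →₀ k
  facet : ι → Finset E
  cycle_mem : ∀ α, cycle α ∈ cliqueChains k (S : Set E) m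
  boundary_cycle : ∀ α, boundary k r (cycle α) = 0
  cycle_facet_self : ∀ α, cycle α (facet α) ≠ 0
  cycle_facet_of_ne : ∀ α β, α ≠ β → cycle α (facet β) = 0
  mem_facet : ∀ α, ∀ v ∈ S, (∀ u ∈ facet α, dist v u ≤ 1) → v ∈ facet α

namespace FacetCycles

variable {k : Type*} [Field k] {E : Type*} [MetricSpace E] {r : E → E → Prop}
  {S : Finset E} {m : ℕ} {ι : Type*}

theorem facet_prop (A : FacetCycles k r S m ι) (α : ι) :
    A.facet α ⊆ S ∧ (∀ u ∈ A.facet α, ∀ v ∈ A.facet α, dist u v ≤ 1) ∧ (A.facet α).card = m := by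
  have := (Finsupp.mem_supported k _).mp (A.cycle_mem α)
    (Finsupp.mem_support_iff.mpr (A.cycle_facet_self α))
  exact ⟨Finset.coe_subset.mp this.1, this.2⟩

/-- Chains one dimension up have boundaries vanishing on maximal faces. -/
theorem boundary_apply_facet (A : FacetCycles k r S m ι) (α : ι) {w : Finset E →₀ k} {m' : ℕ}
    (hw : w ∈ cliqueChains k (S : Set E) m') : boundary k r w (A.facet α) = 0 := by
  classical
  rw [boundary, Finsupp.linearCombination_apply, Finsupp.sum, Finsupp.finsetSum_apply]
  refine Finset.sum_eq_zero fun G hG => ?_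
  obtain ⟨hGS, hGc, -⟩ := (Finsupp.mem_supported k w).mp hw hG
  rw [Finsupp.smul_apply, Finsupp.finsetSum_apply, Finset.sum_eq_zero, smul_zero]
  intro v hv
  rw [Finsupp.single_apply, if_neg]
  intro h
  have : v ∈ A.facet α := A.mem_facet α v (hGS hv) fun u hu =>
    hGc v hv u (Finset.mem_of_mem_erase (h ▸ hu))
  rw [← h] at this
  simp at this

/-- A relation among the classes writes a combination of the cycles as a boundary; evaluating at the
maximal face of index `β` isolates the coefficient of `β`. -/
theorem card_le_reducedBetti [Fintype ι] [IsStrictTotalOrder E r] {p : ℕ}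
    (A : FacetCycles k r S (p + 1) ι) :
    Fintype.card ι ≤ reducedBetti k (ripsComplex 1 S) p := by
  classical
  rw [reducedBetti_eq_finrank r]
  set K := ripsComplex 1 S
  have hmem : ∀ α, A.cycle α ∈ cycles k r K p := fun α =>
    ⟨cliqueChains_eq_chains (k := k) S (p + 1) ▸ A.cycle_mem α, A.boundary_cycle α⟩
  -- The ambient chain space may be infinite-dimensional, where `finrank` could be the default `0`;
  -- the cycles live on the finitely many subsets of `S`.
  have hfin : Module.Finite k (cycles k r K p) := by
    let T := Finsupp.supported k k (S.powerset : Set (Finset E))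
    have hle : cycles k r K p ≤ T := by
      refine inf_le_left.trans ?_
      rw [← cliqueChains_eq_chains]
      exact Finsupp.supported_mono fun F hF => Finset.mem_coe.mpr (Finset.mem_powerset.mpr
        (Finset.coe_subset.mp hF.1))
    let eT : T ≃ₗ[k] ((S.powerset : Set (Finset E)) →₀ k) := Finsupp.supportedEquivFinsupp _
    have : Module.Finite k T := Module.Finite.equiv eT.symm
    exact Submodule.finiteDimensional_of_le hle
  refine LinearIndependent.fintype_card_le_finrank
    (b := fun α => Submodule.Quotient.mk (⟨A.cycle α, hmem α⟩ : cycles k r K p)) ?_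
  rw [Fintype.linearIndependent_iff]
  intro g hg β
  have h1 : (Submodule.Quotient.mk (∑ α, g α • (⟨A.cycle α, hmem α⟩ : cycles k r K p)) :
      reducedHomology k r K p) = 0 := by
    rw [← hg]
    simp only [← Submodule.mkQ_apply, map_sum, map_smul]
  rw [Submodule.Quotient.mk_eq_zero] at h1
  obtain ⟨w, hw, h2⟩ := h1
  have hw' : w ∈ cliqueChains k (S : Set E) (p + 2) := by
    rw [cliqueChains_eq_chains]; exact hw
  have h3 := A.boundary_apply_facet β hw'
  rw [h2] at h3
  simp only [Submodule.subtype_apply, Submodule.coe_sum, Submodule.coe_smul,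
    Finsupp.finsetSum_apply, Finsupp.smul_apply] at h3
  rw [Finset.sum_eq_single_of_mem β (Finset.mem_univ _)
    (fun α _ h => by rw [A.cycle_facet_of_ne α β h, smul_zero])] at h3
  exact (smul_eq_zero.mp h3).resolve_right (A.cycle_facet_self β)

end FacetCycles

end

end Rips

/-! ### Joins with ladders -/

namespace Rips

noncomputable section

section

variable {k : Type*} [Field k] {E : Type*} [MetricSpace E]

/-- The join of a chain with the quadrilateral with diagonals `x₀ y₁` and `y₀ x₁`. -/
def quad (k : Type*) [Field k] {V : Type*} (r : V → V → Prop) (x₀ y₀ x₁ y₁ : V) :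
    (Finset V →₀ k) →ₗ[k] (Finset V →₀ k) :=
  (cone k r x₀ - cone k r y₁) ∘ₗ (cone k r y₀ - cone k r x₁)

/-- For a cycle `w`, any cone `v ∧ w` has boundary `w`, so the difference of two cones is a cycle.
This is used twice. -/
theorem boundary_quad {V : Type*} (r : V → V → Prop) [IsStrictTotalOrder V r] (x₀ y₀ x₁ y₁ : V)
    {w : Finset V →₀ k} (hw : boundary k r w = 0) : boundary k r (quad k r x₀ y₀ x₁ y₁ w) = 0 := by
  simp only [quad, LinearMap.comp_apply, LinearMap.sub_apply, map_sub, boundary_cone, hw, map_zero]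
  abel

/-- Of the four edges of the quadrilateral only `x₁ y₁` avoids both reference vertices `x₀` and
`y₀`. -/
theorem quad_apply {V : Type*} (r : V → V → Prop) {x₀ y₀ x₁ y₁ : V} (w : Finset V →₀ k)
    {F : Finset V} (hx : x₀ ∉ F) (hy : y₀ ∉ F) :
    quad k r x₀ y₀ x₁ y₁ w F = cone k r y₁ (cone k r x₁ w) F := by
  classical
  simp only [quad, LinearMap.comp_apply, LinearMap.sub_apply, map_sub, Finsupp.sub_apply]
  rw [cone_apply_of_notMem r _ hx, cone_apply_of_notMem r _ hx]
  have : cone k r y₁ (cone k r y₀ w) F = 0 := by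
    rw [cone_apply]
    split_ifs
    · rw [cone_apply_of_notMem r _ (fun h => hy (Finset.mem_of_mem_erase h)), zero_mul]
    · rfl
  rw [this]
  abel

/-- Distinctness is not assumed but follows from adjacency: a coincidence would bring a point within
distance `1` of a point with a different rung index. The index `l` witnesses that there are at least
two rungs. -/
theorem FacetCycles.ladder_disjoint {r : E → E → Prop} {S : Finset E} {m : ℕ}
    {ι : Type*} (A : FacetCycles k r S m ι) {L : ℕ} (x y : Fin (L + 1) → E)
    (hxx : ∀ i j, dist (x i) (x j) ≤ 1) (hyy : ∀ i j, dist (y i) (y j) ≤ 1)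
    (hxy : ∀ i j, dist (x i) (y j) ≤ 1 ↔ i = j) (hxS : ∀ i, ∀ s ∈ S, dist (x i) s ≤ 1)
    (hyS : ∀ i, ∀ s ∈ S, dist (y i) s ≤ 1) (l : Fin L) (α : ι) :
    (∀ i j, x i = x j → i = j) ∧ (∀ i j, y i = y j → i = j) ∧
    (∀ (i : Fin L) (j), x i.succ ≠ y j) ∧ (∀ (i : Fin L) (j), y i.succ ≠ x j) ∧
    (∀ i, x i ∉ A.facet α) ∧ (∀ i, y i ∉ A.facet α) := by
  refine ⟨fun i j h => (hxy _ _).mp (h ▸ (hxy _ _).mpr rfl),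
    fun i j h => (hxy _ _).mp (h ▸ (hxy _ _).mpr rfl),
    fun i j h => (Fin.succ_ne_zero i) ((hxy _ _).mp (by rw [h]; exact hyy j 0)),
    fun i j h => (Fin.succ_ne_zero i).symm ((hxy _ _).mp (by rw [h]; exact hxx 0 j)),
    fun i h => ?_, fun i h => ?_⟩
  · have h1 : ∀ j, i = j := fun j => (hxy i j).mp <| by
      rw [dist_comm]; exact hyS j _ ((A.facet_prop α).1 h)
    exact (Fin.succ_ne_zero l).symm ((h1 0).symm.trans (h1 _))
  · have h1 : ∀ j, j = i := fun j => (hxy j i).mp <| hxS j _ ((A.facet_prop α).1 h)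
    exact (Fin.succ_ne_zero l).symm ((h1 0).trans (h1 _).symm)

open Classical in
/-- Joining with a ladder: two families of points `x i` and `y i` in which, among the pairs
`x i`, `y j`, only the rungs `x i`, `y i` are at distance `≤ 1`. -/
def FacetCycles.joinLadder {r : E → E → Prop} [IsStrictTotalOrder E r] {S : Finset E} {m : ℕ}
    {ι : Type*} (A : FacetCycles k r S m ι) {L : ℕ} (x y : Fin (L + 1) → E)
    (hxx : ∀ i j, dist (x i) (x j) ≤ 1) (hyy : ∀ i j, dist (y i) (y j) ≤ 1)
    (hxy : ∀ i j, dist (x i) (y j) ≤ 1 ↔ i = j) (hxS : ∀ i, ∀ s ∈ S, dist (x i) s ≤ 1)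
    (hyS : ∀ i, ∀ s ∈ S, dist (y i) s ≤ 1) :
    FacetCycles k r (S ∪ Finset.univ.image x ∪ Finset.univ.image y) (m + 2) (ι × Fin L) where
  cycle α := quad k r (x 0) (y 0) (x α.2.succ) (y α.2.succ) (A.cycle α.1)
  facet α := insert (y α.2.succ) (insert (x α.2.succ) (A.facet α.1))
  cycle_mem := by
    rintro ⟨α, i⟩
    have hyx : ∀ i, dist (y i) (x i) ≤ 1 := fun i => by rw [dist_comm]; exact (hxy i i).mpr rfl
    have key : ∀ u v : E, (∃ i, u = x i ∨ u = y i) → (∃ i, v = x i ∨ v = y i) → dist u v ≤ 1 →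
        cone k r u (cone k r v (A.cycle α)) ∈ cliqueChains k
          ((S ∪ Finset.univ.image x ∪ Finset.univ.image y : Finset E) : Set E) (m + 2) := by
      intro u v hu hv huv
      have hS : ∀ w : E, (∃ i, w = x i ∨ w = y i) → ∀ s ∈ (S : Set E), dist w s ≤ 1 := by
        rintro w ⟨i, rfl | rfl⟩ s hs
        · exact hxS i s hs
        · exact hyS i s hs
      refine cliqueChains_mono ?_ _ (cone_mem_cliqueChains r (cone_mem_cliqueChains r
        (A.cycle_mem α) (hS v hv)) (v := u) ?_)
      · intro w hw
        simp only [Finset.coe_union, Set.mem_union, Finset.coe_image, Finset.coe_univ,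
          Set.image_univ, Set.mem_range]
        rcases hw with rfl | rfl | hw
        · obtain ⟨i, rfl | rfl⟩ := hu <;> simp
        · obtain ⟨i, rfl | rfl⟩ := hv <;> simp
        · exact Or.inl (Or.inl hw)
      · rintro w (rfl | hw)
        · exact huv
        · exact hS u hu w hw
    simp only [quad, LinearMap.comp_apply, LinearMap.sub_apply, map_sub]
    refine Submodule.sub_mem _ (Submodule.sub_mem _ ?_ ?_) (Submodule.sub_mem _ ?_ ?_)
    · exact key _ _ ⟨_, Or.inl rfl⟩ ⟨_, Or.inr rfl⟩ ((hxy 0 0).mpr rfl)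
    · exact key _ _ ⟨_, Or.inr rfl⟩ ⟨_, Or.inr rfl⟩ (hyy _ _)
    · exact key _ _ ⟨_, Or.inl rfl⟩ ⟨_, Or.inl rfl⟩ (hxx _ _)
    · exact key _ _ ⟨_, Or.inr rfl⟩ ⟨_, Or.inl rfl⟩ (hyx _)
  boundary_cycle α := boundary_quad r _ _ _ _ (A.boundary_cycle α.1)
  cycle_facet_self := by
    rintro ⟨α, i⟩
    obtain ⟨hinjx, hinjy, hne, hne', hxF, hyF⟩ := A.ladder_disjoint x y hxx hyy hxy hxS hyS i α
    have hinj : x 0 ≠ x i.succ := fun h => (Fin.succ_ne_zero i).symm (hinjx _ _ h)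
    have hinj' : y 0 ≠ y i.succ := fun h => (Fin.succ_ne_zero i).symm (hinjy _ _ h)
    dsimp only
    rw [quad_apply, Ne, cone_apply_eq_zero_iff _ _ (Finset.mem_insert_self _ _),
      Finset.erase_insert, cone_apply_eq_zero_iff _ _ (Finset.mem_insert_self _ _),
      Finset.erase_insert (hxF _)]
    · exact A.cycle_facet_self α
    · simp [hne', hyF]
    · simp [hxF, hinj, (hne' i 0).symm]
    · simp [hyF, hinj', (hne i 0).symm]
  cycle_facet_of_ne := by
    rintro ⟨α, i⟩ ⟨β, j⟩ hαβ
    obtain ⟨hinjx, hinjy, hne, hne', hxF, hyF⟩ := A.ladder_disjoint x y hxx hyy hxy hxS hyS i β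
    dsimp only
    rw [quad_apply]
    · by_cases hij : i = j
      · subst hij
        have hαβ' : α ≠ β := fun h => hαβ (by rw [h])
        rw [cone_apply_eq_zero_iff _ _ (Finset.mem_insert_self _ _),
          Finset.erase_insert, cone_apply_eq_zero_iff _ _ (Finset.mem_insert_self _ _),
          Finset.erase_insert (hxF _)]
        · exact A.cycle_facet_of_ne α β hαβ'
        · simp [hne', hyF]
      · apply cone_apply_of_notMem
        simp only [Finset.mem_insert, not_or]
        exact ⟨fun h => hij (Fin.succ_injective _ (hinjy _ _ h)), hne' _ _, hyF _⟩
    · simp only [Finset.mem_insert, not_or]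
      exact ⟨(hne' _ _).symm, fun h => (Fin.succ_ne_zero j).symm (hinjx _ _ h), hxF _⟩
    · simp only [Finset.mem_insert, not_or]
      exact ⟨fun h => (Fin.succ_ne_zero j).symm (hinjy _ _ h), (hne _ _).symm, hyF _⟩
  mem_facet := by
    rintro ⟨α, i⟩ v hv h
    simp only [Finset.mem_insert, forall_eq_or_imp] at h ⊢
    simp only [Finset.mem_union, Finset.mem_image, Finset.mem_univ, true_and] at hv
    obtain ⟨h1, h2, h3⟩ := h
    -- A vertex of the ladder near both ends of a rung belongs to that rung; a vertex of `S` is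
    -- handled by maximality of the old face.
    rcases hv with (hv | ⟨j, rfl⟩) | ⟨j, rfl⟩
    · exact Or.inr (Or.inr (A.mem_facet α v hv h3))
    · rw [(hxy _ _).mp h1]; simp
    · rw [dist_comm] at h2
      rw [(hxy _ _).mp h2]; simp

/-- The empty complex has the empty face as a cycle and a maximal face. -/
def FacetCycles.empty (k : Type*) [Field k] (r : E → E → Prop) :
    FacetCycles k r (∅ : Finset E) 0 Unit where
  cycle _ := Finsupp.single ∅ 1
  facet _ := ∅
  cycle_mem _ := single_empty_mem_cliqueChains _ _
  boundary_cycle _ := boundary_empty r 1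
  cycle_facet_self _ := by simp
  cycle_facet_of_ne α β h := absurd rfl h
  mem_facet := by simp

/-! ### Spheres in the grid -/

/-- The triangle `u v w` as a chain. -/
def tri (k : Type*) [Field k] {V : Type*} (r : V → V → Prop) (u v w : V) : Finset V →₀ k :=
  cone k r u (cone k r v (cone k r w (Finsupp.single ∅ 1)))

/-- The cone from `u₀` over the quadrilateral with diagonals `u₀ u₁` and `v₀ v₁`, including the two
degenerate triangles, which vanish. -/
def fan (k : Type*) [Field k] {V : Type*} (r : V → V → Prop) (u₀ u₁ v₀ v₁ : V) : Finset V →₀ k :=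
  tri k r u₀ u₁ v₁ - tri k r u₀ u₁ v₀ - tri k r u₀ u₀ v₁ + tri k r u₀ u₀ v₀

theorem tri_mem_cliqueChains (r : E → E → Prop) {U : Set E} {u v w : E} (hu : u ∈ U) (hv : v ∈ U)
    (hw : w ∈ U) (huv : dist u v ≤ 1) (huw : dist u w ≤ 1) (hvw : dist v w ≤ 1) :
    tri k r u v w ∈ cliqueChains k U 3 := by
  have h1 := cone_mem_cliqueChains r (single_empty_mem_cliqueChains (∅ : Set E) (1 : k)) (v := w)
    (by simp)
  have h2 := cone_mem_cliqueChains r h1 (v := v) (by simpa using hvw)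
  have h3 := cone_mem_cliqueChains r h2 (v := u) (by simpa using ⟨huv, huw⟩)
  refine cliqueChains_mono ?_ _ h3
  rintro _ (rfl | rfl | rfl | h)
  · exact hu
  · exact hv
  · exact hw
  · exact h.elim

theorem tri_apply_of_notMem {V : Type*} (r : V → V → Prop) {u v w : V} {F : Finset V}
    (h : u ∉ F ∨ v ∉ F ∨ w ∉ F) : tri k r u v w F = 0 := by
  classical
  by_contra hne
  by_cases hu : u ∈ F
  · rw [tri, cone_apply_eq_zero_iff r _ hu] at hne
    by_cases hv : v ∈ F.erase u
    · rw [cone_apply_eq_zero_iff r _ hv] at hne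
      by_cases hw : w ∈ (F.erase u).erase v
      · simp only [Finset.mem_erase] at hv hw
        tauto
      · exact hne (cone_apply_of_notMem r _ hw)
    · exact hne (cone_apply_of_notMem r _ hv)
  · exact hne (cone_apply_of_notMem r _ hu)

open Classical in
theorem tri_apply_self {V : Type*} (r : V → V → Prop) {u v w : V} (huv : u ≠ v) (huw : u ≠ w)
    (hvw : v ≠ w) : tri k r u v w {u, v, w} ≠ 0 := by
  rw [tri, Ne, cone_apply_eq_zero_iff r _ (by simp), Finset.erase_insert (by simp [huv, huw]),
    cone_apply_eq_zero_iff r _ (by simp), Finset.erase_insert (by simp [hvw]),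
    cone_apply_eq_zero_iff r _ (by simp)]
  simp

theorem boundary_tri {V : Type*} (r : V → V → Prop) [IsStrictTotalOrder V r] (u v w : V) :
    boundary k r (tri k r u v w) = cone k r v (cone k r w (Finsupp.single ∅ 1))
      - cone k r u (cone k r w (Finsupp.single ∅ 1))
      + cone k r u (cone k r v (Finsupp.single ∅ 1)) := by
  simp only [tri, boundary_cone, boundary_empty, map_sub, map_zero, sub_zero]
  abel

/-- The fan is `u₀ ∧ (u₁ - u₀) ∧ (v₁ - v₀)`, so its boundary is the quadrilateral `(u₁ - u₀) ∧ (v₁ -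
v₀)`. -/
theorem boundary_fan {V : Type*} (r : V → V → Prop) [IsStrictTotalOrder V r] (u₀ u₁ v₀ v₁ : V) :
    boundary k r (fan k r u₀ u₁ v₀ v₁) = cone k r u₁ (cone k r v₁ (Finsupp.single ∅ 1))
      - cone k r u₁ (cone k r v₀ (Finsupp.single ∅ 1))
      - cone k r u₀ (cone k r v₁ (Finsupp.single ∅ 1))
      + cone k r u₀ (cone k r v₀ (Finsupp.single ∅ 1)) := by
  simp only [fan, map_sub, map_add, boundary_tri]
  abel

theorem fan_mem_cliqueChains (r : E → E → Prop) {U : Set E} {u₀ u₁ v₀ v₁ : E} (hu₀ : u₀ ∈ U)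
    (hu₁ : u₁ ∈ U) (hv₀ : v₀ ∈ U) (hv₁ : v₁ ∈ U) (huu : dist u₀ u₁ ≤ 1) (h00 : dist u₀ v₀ ≤ 1)
    (h01 : dist u₀ v₁ ≤ 1) (h10 : dist u₁ v₀ ≤ 1) (h11 : dist u₁ v₁ ≤ 1) :
    fan k r u₀ u₁ v₀ v₁ ∈ cliqueChains k U 3 := by
  have h : dist u₀ u₀ ≤ 1 := by simp
  exact Submodule.add_mem _ (Submodule.sub_mem _ (Submodule.sub_mem _
    (tri_mem_cliqueChains r hu₀ hu₁ hv₁ huu h01 h11)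
    (tri_mem_cliqueChains r hu₀ hu₁ hv₀ huu h00 h10))
    (tri_mem_cliqueChains r hu₀ hu₀ hv₁ h h01 h01))
    (tri_mem_cliqueChains r hu₀ hu₀ hv₀ h h00 h00)

theorem fan_apply_of_notMem {V : Type*} (r : V → V → Prop) {u₀ u₁ v₀ v₁ : V} {F : Finset V}
    (h : u₀ ∉ F) : fan k r u₀ u₁ v₀ v₁ F = 0 := by
  simp [fan, tri_apply_of_notMem r (Or.inl h)]

section Grid

variable {V : Type*} {N : ℕ} (a b c : Fin (N + 1) → Fin (N + 1) → V)

/-- The sphere formed by the triangles `a i j`, `b j k`, `c k i` with indices in `{0, i}`, `{0, j}`,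
`{0, l}` and twelve quadrilaterals, each filled inside two of the three clusters. -/
def gridSphere (k : Type*) [Field k] (r : V → V → Prop) (i j l : Fin (N + 1)) : Finset V →₀ k :=
  tri k r (a i j) (b j l) (c l i) - tri k r (a 0 j) (b j l) (c l 0)
  - tri k r (a i 0) (b 0 l) (c l i) - tri k r (a i j) (b j 0) (c 0 i)
  + tri k r (a 0 0) (b 0 l) (c l 0) + tri k r (a 0 j) (b j 0) (c 0 0)
  + tri k r (a i 0) (b 0 0) (c 0 i) - tri k r (a 0 0) (b 0 0) (c 0 0)
  - fan k r (a 0 j) (a i j) (b j 0) (b j l) + fan k r (a 0 0) (a i 0) (b 0 0) (b 0 l)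
  - fan k r (b 0 l) (b j l) (c l 0) (c l i) + fan k r (b 0 0) (b j 0) (c 0 0) (c 0 i)
  + fan k r (a i 0) (a i j) (c 0 i) (c l i) - fan k r (a 0 0) (a 0 j) (c 0 0) (c l 0)

/-- The eight triangles and six squares form a cuboctahedron. A triangle carries the sign of the
parity of its number of zeroed indices, so for fixed `j` the edges between `a` and `b` sum to `± (a
i j - a 0 j) ∧ (b j l - b j 0)`, the boundary of a fan; the other two pairs of clusters behave
alike. -/
theorem boundary_gridSphere (r : V → V → Prop) [IsStrictTotalOrder V r] (i j l : Fin (N + 1)) :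
    boundary k r (gridSphere a b c k r i j l) = 0 := by
  simp only [gridSphere, map_sub, map_add, boundary_tri, boundary_fan]
  abel

/-- Every other triangle has a vertex with index `0`, and so does the apex `u₀` of every fan. -/
theorem gridSphere_apply (r : V → V → Prop) (i j l : Fin (N + 1)) {F : Finset V}
    (ha : ∀ t, a 0 t ∉ F) (ha' : ∀ t, a t 0 ∉ F) (hb : ∀ t, b 0 t ∉ F) (hc : ∀ t, c 0 t ∉ F) :
    gridSphere a b c k r i j l F = tri k r (a i j) (b j l) (c l i) F := by
  simp [gridSphere, tri_apply_of_notMem, fan_apply_of_notMem, ha, ha', hb, hc]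

-- A vertex of the triangle is within distance `1` of all three corners, and two of these
-- adjacencies determine its two indices. This also covers possible coincidences between points of
-- different clusters.
open Classical in
theorem mem_triangle (a b c : Fin (N + 1) → Fin (N + 1) → E)
    (haa : ∀ i j i' j', dist (a i j) (a i' j') ≤ 1) (hbb : ∀ i j i' j', dist (b i j) (b i' j') ≤ 1)
    (hcc : ∀ i j i' j', dist (c i j) (c i' j') ≤ 1)
    (hab : ∀ i j j' l, dist (a i j) (b j' l) ≤ 1 ↔ j = j')
    (hbc : ∀ i j j' l, dist (b i j) (c j' l) ≤ 1 ↔ j = j')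
    (hca : ∀ i j j' l, dist (c i j) (a j' l) ≤ 1 ↔ j = j') (i j l : Fin (N + 1)) :
    (∀ s t, a s t ∈ ({a i j, b j l, c l i} : Finset E) → s = i ∧ t = j) ∧
    (∀ s t, b s t ∈ ({a i j, b j l, c l i} : Finset E) → s = j ∧ t = l) ∧
    (∀ s t, c s t ∈ ({a i j, b j l, c l i} : Finset E) → s = l ∧ t = i) := by
  have key : ∀ v ∈ ({a i j, b j l, c l i} : Finset E),
      dist v (a i j) ≤ 1 ∧ dist v (b j l) ≤ 1 ∧ dist v (c l i) ≤ 1 := by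
    intro v hv
    simp only [Finset.mem_insert, Finset.mem_singleton] at hv
    have h1 := (hab i j j l).mpr rfl
    have h2 := (hbc j l l i).mpr rfl
    have h3 := (hca l i i j).mpr rfl
    rcases hv with rfl | rfl | rfl
    · exact ⟨haa _ _ _ _, h1, by rwa [dist_comm]⟩
    · exact ⟨by rwa [dist_comm], hbb _ _ _ _, h2⟩
    · exact ⟨h3, by rwa [dist_comm], hcc _ _ _ _⟩
  refine ⟨fun s t h => ?_, fun s t h => ?_, fun s t h => ?_⟩ <;> obtain ⟨h1, h2, h3⟩ := key _ h
  · rw [dist_comm] at h3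
    exact ⟨((hca _ _ _ _).mp h3).symm, (hab _ _ _ _).mp h2⟩
  · rw [dist_comm] at h1
    exact ⟨((hab _ _ _ _).mp h1).symm, (hbc _ _ _ _).mp h3⟩
  · rw [dist_comm] at h2
    exact ⟨((hbc _ _ _ _).mp h2).symm, (hca _ _ _ _).mp h1⟩

end Grid

open Classical in
/-- The family of maximal triangles `a i j`, `b j l`, `c l i` in three clusters of points. -/
def FacetCycles.grid (k : Type*) [Field k] (r : E → E → Prop) [IsStrictTotalOrder E r] {N : ℕ}
    (a b c : Fin (N + 1) → Fin (N + 1) → E)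
    (haa : ∀ i j i' j', dist (a i j) (a i' j') ≤ 1) (hbb : ∀ i j i' j', dist (b i j) (b i' j') ≤ 1)
    (hcc : ∀ i j i' j', dist (c i j) (c i' j') ≤ 1)
    (hab : ∀ i j j' l, dist (a i j) (b j' l) ≤ 1 ↔ j = j')
    (hbc : ∀ i j j' l, dist (b i j) (c j' l) ≤ 1 ↔ j = j')
    (hca : ∀ i j j' l, dist (c i j) (a j' l) ≤ 1 ↔ j = j') :
    FacetCycles k r (Finset.univ.image (Function.uncurry a) ∪ Finset.univ.image (Function.uncurry b)
      ∪ Finset.univ.image (Function.uncurry c)) 3 (Fin N × Fin N × Fin N) where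
  cycle α := gridSphere a b c k r α.1.succ α.2.1.succ α.2.2.succ
  facet α := {a α.1.succ α.2.1.succ, b α.2.1.succ α.2.2.succ, c α.2.2.succ α.1.succ}
  cycle_mem := by
    rintro ⟨i, j, l⟩
    set U : Finset E := Finset.univ.image (Function.uncurry a) ∪
      Finset.univ.image (Function.uncurry b) ∪ Finset.univ.image (Function.uncurry c)
    have ha : ∀ i j, a i j ∈ (U : Set E) := fun i j => by simp [U]
    have hb : ∀ i j, b i j ∈ (U : Set E) := fun i j => by simp [U]
    have hc : ∀ i j, c i j ∈ (U : Set E) := fun i j => by simp [U]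
    have hab' : ∀ i j l, dist (a i j) (b j l) ≤ 1 := fun i j l => (hab _ _ _ _).mpr rfl
    have hbc' : ∀ i j l, dist (b i j) (c j l) ≤ 1 := fun i j l => (hbc _ _ _ _).mpr rfl
    have hac' : ∀ i j l, dist (a i j) (c l i) ≤ 1 := fun i j l => by
      rw [dist_comm]; exact (hca _ _ _ _).mpr rfl
    have ht : ∀ i j l, tri k r (a i j) (b j l) (c l i) ∈ cliqueChains k (U : Set E) 3 :=
      fun i j l => tri_mem_cliqueChains r (ha _ _) (hb _ _) (hc _ _) (hab' _ _ _) (hac' _ _ _)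
        (hbc' _ _ _)
    have f1 : ∀ i i' j l l', fan k r (a i j) (a i' j) (b j l) (b j l') ∈
        cliqueChains k (U : Set E) 3 := fun i i' j l l' =>
      fan_mem_cliqueChains r (ha _ _) (ha _ _) (hb _ _) (hb _ _) (haa _ _ _ _) (hab' _ _ _)
        (hab' _ _ _) (hab' _ _ _) (hab' _ _ _)
    have f2 : ∀ i i' j l l', fan k r (b i j) (b i' j) (c j l) (c j l') ∈
        cliqueChains k (U : Set E) 3 := fun i i' j l l' =>
      fan_mem_cliqueChains r (hb _ _) (hb _ _) (hc _ _) (hc _ _) (hbb _ _ _ _) (hbc' _ _ _)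
        (hbc' _ _ _) (hbc' _ _ _) (hbc' _ _ _)
    have f3 : ∀ i j j' l l', fan k r (a i j) (a i j') (c l i) (c l' i) ∈
        cliqueChains k (U : Set E) 3 := fun i j j' l l' =>
      fan_mem_cliqueChains r (ha _ _) (ha _ _) (hc _ _) (hc _ _) (haa _ _ _ _) (hac' _ _ _)
        (hac' _ _ _) (hac' _ _ _) (hac' _ _ _)
    dsimp only [gridSphere]
    exact Submodule.sub_mem _ (Submodule.add_mem _ (Submodule.add_mem _ (Submodule.sub_mem _
      (Submodule.add_mem _ (Submodule.sub_mem _ (Submodule.sub_mem _ (Submodule.add_mem _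
      (Submodule.add_mem _ (Submodule.add_mem _ (Submodule.sub_mem _ (Submodule.sub_mem _
      (Submodule.sub_mem _
      (ht _ _ _)
      (ht _ _ _))
      (ht _ _ _))
      (ht _ _ _))
      (ht _ _ _))
      (ht _ _ _))
      (ht _ _ _))
      (ht _ _ _))
      (f1 _ _ _ _ _))
      (f1 _ _ _ _ _))
      (f2 _ _ _ _ _))
      (f2 _ _ _ _ _))
      (f3 _ _ _ _ _))
      (f3 _ _ _ _ _)
  boundary_cycle α := boundary_gridSphere a b c r _ _ _
  cycle_facet_self := by
    rintro ⟨i, j, l⟩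
    have h0 : ∀ i : Fin N, (0 : Fin (N + 1)) ≠ i.succ := fun i => (Fin.succ_ne_zero i).symm
    obtain ⟨ha, hb, hc⟩ := mem_triangle a b c haa hbb hcc hab hbc hca i.succ j.succ l.succ
    dsimp only
    rw [gridSphere_apply]
    · refine tri_apply_self r (fun h => ?_) (fun h => ?_) (fun h => ?_)
      · refine h0 j ((hab i.succ 0 j.succ l.succ).mp ?_)
        rw [← h]; exact haa _ _ _ _
      · refine h0 i ((hca l.succ i.succ 0 j.succ).mp ?_).symm
        rw [← h]; exact haa _ _ _ _
      · refine h0 l ((hbc j.succ 0 l.succ i.succ).mp ?_)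
        rw [← h]; exact hbb _ _ _ _
    · exact fun t h => h0 _ (ha _ _ h).1
    · exact fun t h => h0 _ (ha _ _ h).2
    · exact fun t h => h0 _ (hb _ _ h).1
    · exact fun t h => h0 _ (hc _ _ h).1
  cycle_facet_of_ne := by
    rintro ⟨i, j, l⟩ ⟨i', j', l'⟩ hne
    have h0 : ∀ i : Fin N, (0 : Fin (N + 1)) ≠ i.succ := fun i => (Fin.succ_ne_zero i).symm
    obtain ⟨ha, hb, hc⟩ := mem_triangle a b c haa hbb hcc hab hbc hca i'.succ j'.succ l'.succ
    dsimp only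
    rw [gridSphere_apply]
    · apply tri_apply_of_notMem
      by_contra! h
      have h1 := ha _ _ h.1
      have h2 := hb _ _ h.2.1
      rw [Fin.succ_inj, Fin.succ_inj] at h1 h2
      exact hne (by rw [h1.1, h1.2, h2.2])
    · exact fun t h => h0 _ (ha _ _ h).1
    · exact fun t h => h0 _ (ha _ _ h).2
    · exact fun t h => h0 _ (hb _ _ h).1
    · exact fun t h => h0 _ (hc _ _ h).1
  mem_facet := by
    rintro ⟨i, j, l⟩ v hv h
    simp only [Finset.mem_insert, Finset.mem_singleton, forall_eq_or_imp, forall_eq] at h ⊢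
    simp only [Finset.mem_union, Finset.mem_image, Finset.mem_univ, true_and, Prod.exists,
      Function.uncurry_apply_pair] at hv
    obtain ⟨h1, h2, h3⟩ := h
    rcases hv with (⟨s, t, rfl⟩ | ⟨s, t, rfl⟩) | ⟨s, t, rfl⟩
    · rw [dist_comm] at h3
      rw [(hab _ _ _ _).mp h2, ← (hca _ _ _ _).mp h3]; simp
    · rw [dist_comm] at h1
      rw [← (hab _ _ _ _).mp h1, (hbc _ _ _ _).mp h3]; simp
    · rw [dist_comm] at h2
      rw [← (hbc _ _ _ _).mp h2, (hca _ _ _ _).mp h1]; simp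

end

end

end Rips

/-! ### Realisation in Euclidean space -/

namespace Rips

open Filter Topology

/-- Scaling the second axis by `√3 / 2` gives the equilateral triangle of side `1` rational
coordinates, so that later identities are polynomial. The remaining `d - 5` coordinates are zero. -/
theorem exists_coordinates {d : ℕ} (hd : 5 ≤ d) :
    ∃ pt : ℝ → ℝ → ℝ → ℝ → ℝ → EuclideanSpace ℝ (Fin d),
      ∀ a b c e f a' b' c' e' f', dist (pt a b c e f) (pt a' b' c' e' f') ≤ 1 ↔
        (a - a') ^ 2 + 3 / 4 * (b - b') ^ 2 + (c - c') ^ 2 + (e - e') ^ 2 + (f - f') ^ 2 ≤ 1 := by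
  obtain ⟨d, rfl⟩ := Nat.exists_eq_add_of_le hd
  refine ⟨fun a b c e f => WithLp.toLp 2
    (Fin.append ![a, √3 / 2 * b, c, e, f] (0 : Fin d → ℝ)), ?_⟩
  intro a b c e f a' b' c' e' f'
  have h3 : √3 ^ 2 = (3 : ℝ) := Real.sq_sqrt (by norm_num)
  rw [EuclideanSpace.dist_eq, Real.sqrt_le_one, Fin.sum_univ_add]
  simp only [Fin.append_left, Fin.append_right, Real.dist_eq, sq_abs, Fin.sum_univ_five]
  simp only [Matrix.cons_val, Pi.zero_apply, sub_self]
  have : (√3 / 2 * b - √3 / 2 * b') ^ 2 = 3 / 4 * (b - b') ^ 2 := by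
    linear_combination ((b - b') ^ 2 / 4) * h3
  rw [this]
  simp

/-- The rational parametrisation of the circle at the integers `l` gives unit vectors on distinct
lines: `1` minus and plus the inner product are positive multiples of `(l - m) ^ 2` and `(1 + l m) ^
2`. -/
theorem exists_lines : ∃ c s : ℕ → ℝ, (∀ l, c l ^ 2 + s l ^ 2 = 1) ∧ ∀ l m, l ≠ m →
    c l * c m + s l * s m < 1 ∧ -1 < c l * c m + s l * s m := by
  refine ⟨fun l => (1 - (l : ℝ) ^ 2) / (1 + (l : ℝ) ^ 2), fun l => 2 * l / (1 + (l : ℝ) ^ 2),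
    fun l => ?_, fun l m h => ?_⟩
  · have : (1 + (l : ℝ) ^ 2) ≠ 0 := by positivity
    field_simp
    ring
  · have h1 : 0 < 1 + (l : ℝ) ^ 2 := by positivity
    have h2 : 0 < 1 + (m : ℝ) ^ 2 := by positivity
    have h3 : (0 : ℝ) < ((l : ℝ) - m) ^ 2 := by
      have : ((l : ℝ) - m) ≠ 0 := sub_ne_zero.mpr (by exact_mod_cast h)
      positivity
    have h4 : (0 : ℝ) < (1 + (l : ℝ) * m) ^ 2 := by positivity
    have e : (1 - (l : ℝ) ^ 2) / (1 + (l : ℝ) ^ 2) * ((1 - (m : ℝ) ^ 2) / (1 + (m : ℝ) ^ 2)) +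
        2 * l / (1 + (l : ℝ) ^ 2) * (2 * m / (1 + (m : ℝ) ^ 2)) =
        ((1 - (l : ℝ) ^ 2) * (1 - (m : ℝ) ^ 2) + 4 * l * m) /
          ((1 + (l : ℝ) ^ 2) * (1 + (m : ℝ) ^ 2)) := by
      field_simp
      ring
    simp only [e]
    rw [div_lt_one (by positivity), lt_div_iff₀ (by positivity)]
    constructor <;> nlinarith

theorem eventually_le_one {f : ℝ → ℝ} (hf : Continuous f) (h : f 0 < 1) :
    ∀ᶠ ε in 𝓝[>] (0 : ℝ), f ε ≤ 1 :=
  ((hf.continuousAt.eventually_lt continuousAt_const h).filter_mono nhdsWithin_le_nhds).mono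
    fun _ h => le_of_lt h

/-- For pairs at limiting distance exactly `1`: the sign of the `ε ^ 2` coefficient decides, for
small `ε`, on which side of `1` the squared distance falls. -/
theorem eventually_le_one_iff {c : ℝ} (hc : c ≠ 0) (Q : ℝ) :
    ∀ᶠ ε in 𝓝[>] (0 : ℝ), 1 + c * ε ^ 2 + Q * ε ^ 4 ≤ 1 ↔ c < 0 := by
  have hcont : Continuous fun ε : ℝ => c + Q * ε ^ 2 := by fun_prop
  have hpos : ∀ᶠ ε in 𝓝[>] (0 : ℝ), 0 < ε := self_mem_nhdsWithin
  rcases hc.lt_or_gt with h | h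
  · have := (hcont.continuousAt.eventually_lt (x₀ := 0) continuousAt_const (by simpa using h :
      _ < (0 : ℝ))).filter_mono (nhdsWithin_le_nhds (s := Set.Ioi 0))
    filter_upwards [this, hpos] with ε h1 h2
    have : 0 < ε ^ 2 := by positivity
    refine iff_of_true ?_ h
    nlinarith
  · have := (continuousAt_const.eventually_lt hcont.continuousAt (x₀ := 0) (by simpa using h :
      (0 : ℝ) < _)).filter_mono (nhdsWithin_le_nhds (s := Set.Ioi 0))
    filter_upwards [this, hpos] with ε h1 h2
    have : 0 < ε ^ 2 := by positivity
    refine iff_of_false ?_ h.not_gt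
    nlinarith

theorem sq_sub_half_neg_iff (i j : ℕ) : ((i : ℝ) - j) ^ 2 - 1 / 2 < 0 ↔ i = j := by
  constructor
  · intro h
    by_contra hne
    have h1 : 1 ≤ |(i : ℤ) - j| := Int.one_le_abs (sub_ne_zero.mpr (by exact_mod_cast hne))
    have h2 : (1 : ℝ) ≤ |(i : ℝ) - j| := by exact_mod_cast h1
    nlinarith [sq_abs ((i : ℝ) - j)]
  · rintro rfl
    norm_num

theorem sq_sub_half_ne_zero (i j : ℕ) : ((i : ℝ) - j) ^ 2 - 1 / 2 ≠ 0 := by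
  by_cases h : i = j
  · subst h; norm_num
  · have h1 : 1 ≤ |(i : ℤ) - j| := Int.one_le_abs (sub_ne_zero.mpr (by exact_mod_cast h))
    have h2 : (1 : ℝ) ≤ |(i : ℝ) - j| := by exact_mod_cast h1
    nlinarith [sq_abs ((i : ℝ) - j)]

/-- Points in three clusters around an equilateral triangle and in `2 q` clusters around pairwise
opposite points of a sphere, with the adjacencies of the join of a grid and `q` ladders. -/
theorem exists_configuration {d : ℕ} (hd : 5 ≤ d) (q L N : ℕ) :
    ∃ (a b c : Fin (N + 1) → Fin (N + 1) → EuclideanSpace ℝ (Fin d))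
      (x : Fin q → Bool → Fin (L + 1) → EuclideanSpace ℝ (Fin d)),
      (∀ i j i' j', dist (a i j) (a i' j') ≤ 1) ∧ (∀ i j i' j', dist (b i j) (b i' j') ≤ 1) ∧
      (∀ i j i' j', dist (c i j) (c i' j') ≤ 1) ∧
      (∀ i j j' l, dist (a i j) (b j' l) ≤ 1 ↔ j = j') ∧
      (∀ i j j' l, dist (b i j) (c j' l) ≤ 1 ↔ j = j') ∧
      (∀ i j j' l, dist (c i j) (a j' l) ≤ 1 ↔ j = j') ∧
      (∀ l s i j, dist (x l s i) (x l s j) ≤ 1) ∧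
      (∀ l i j, dist (x l true i) (x l false j) ≤ 1 ↔ i = j) ∧
      (∀ l m s t i j, l ≠ m → dist (x l s i) (x m t j) ≤ 1) ∧
      (∀ l s t i j, dist (x l s t) (a i j) ≤ 1) ∧ (∀ l s t i j, dist (x l s t) (b i j) ≤ 1) ∧
      (∀ l s t i j, dist (x l s t) (c i j) ≤ 1) := by
  obtain ⟨pt, hpt⟩ := exists_coordinates hd
  obtain ⟨co, si, hcs, hlt⟩ := exists_lines
  -- The sideways displacements of a pair from `a` and `b` add `i ^ 2 + l ^ 2 + (j - j') ^ 2` to the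
  -- `ε ^ 2` coefficient. Moving the two points towards each other by `ε ^ 2 f` removes `2 f i + 2 f
  -- l`, leaving `(j - j') ^ 2 - 1 / 2`; the term `1 / 8` puts the threshold between the integers
  -- `0` and `1`.
  let f : ℕ → ℝ := fun i => (i : ℝ) ^ 2 / 2 + 1 / 8
  -- The planar shift of each point solves two linear conditions, its components along the two edges
  -- of the triangle. For `a i j` these are `f i` towards `b` and `f j` towards `c`, each cancelling
  -- the index not shared with that cluster.
  let a : ℝ → Fin (N + 1) → Fin (N + 1) → EuclideanSpace ℝ (Fin d) := fun ε i j =>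
    pt (-1 / 2 + ε ^ 2 * f i) (-1 / 3 + ε ^ 2 * (4 / 3 * (f j - f i / 2))) (ε * i) (ε * j) 0
  let b : ℝ → Fin (N + 1) → Fin (N + 1) → EuclideanSpace ℝ (Fin d) := fun ε j l =>
    pt (1 / 2 - ε ^ 2 * f l) (-1 / 3 + ε ^ 2 * (4 / 3 * (f j - f l / 2))) 0 (ε * j) (ε * l)
  let c : ℝ → Fin (N + 1) → Fin (N + 1) → EuclideanSpace ℝ (Fin d) := fun ε l i =>
    pt (ε ^ 2 * (f i - f l)) (2 / 3 - ε ^ 2 * (2 / 3 * (f i + f l))) (ε * i) 0 (ε * l)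
  let σ : Bool → ℝ := fun s => if s then 1 else -1
  -- The two clusters of a ladder start at antipodal points and both move along the same tangent
  -- direction.
  let x : ℝ → Fin q → Bool → Fin (L + 1) → EuclideanSpace ℝ (Fin d) := fun ε l s i =>
    pt 0 0 (σ s * co l / 2 - i * ε * si l) (σ s * si l / 2 + i * ε * co l) 0
  have hσ : ∀ s, σ s ^ 2 = 1 := by rintro (_ | _) <;> simp [σ]
  have hpos : ∀ᶠ ε in 𝓝[>] (0 : ℝ), 0 < ε := self_mem_nhdsWithin
  have haa : ∀ᶠ ε in 𝓝[>] (0 : ℝ), ∀ i j i' j', dist (a ε i j) (a ε i' j') ≤ 1 := by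
    simp only [eventually_all, a, hpt]
    exact fun i j i' j' => eventually_le_one (by fun_prop) (by norm_num)
  have hbb : ∀ᶠ ε in 𝓝[>] (0 : ℝ), ∀ i j i' j', dist (b ε i j) (b ε i' j') ≤ 1 := by
    simp only [eventually_all, b, hpt]
    exact fun i j i' j' => eventually_le_one (by fun_prop) (by norm_num)
  have hcc : ∀ᶠ ε in 𝓝[>] (0 : ℝ), ∀ i j i' j', dist (c ε i j) (c ε i' j') ≤ 1 := by
    simp only [eventually_all, c, hpt]
    exact fun i j i' j' => eventually_le_one (by fun_prop) (by norm_num)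
  have hab : ∀ᶠ ε in 𝓝[>] (0 : ℝ), ∀ i j j' l, dist (a ε i j) (b ε j' l) ≤ 1 ↔ j = j' := by
    simp only [eventually_all, a, b, hpt]
    intro i j j' l
    have := eventually_le_one_iff (sq_sub_half_ne_zero j j')
      ((f i + f l) ^ 2 + 3 / 4 * (4 / 3 * (f j - f i / 2) - 4 / 3 * (f j' - f l / 2)) ^ 2)
    simp only [sq_sub_half_neg_iff, Fin.val_inj] at this
    refine this.mono fun ε h => ?_
    rw [← h]
    refine iff_of_eq (congrArg (· ≤ 1) ?_)
    simp only [f]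
    ring
  have hbc : ∀ᶠ ε in 𝓝[>] (0 : ℝ), ∀ i j j' l, dist (b ε i j) (c ε j' l) ≤ 1 ↔ j = j' := by
    simp only [eventually_all, b, c, hpt]
    intro i j j' l
    have := eventually_le_one_iff (sq_sub_half_ne_zero j j')
      ((f j + (f l - f j')) ^ 2 + 3 / 4 * (4 / 3 * (f i - f j / 2) + 2 / 3 * (f l + f j')) ^ 2)
    simp only [sq_sub_half_neg_iff, Fin.val_inj] at this
    refine this.mono fun ε h => ?_
    rw [← h]
    refine iff_of_eq (congrArg (· ≤ 1) ?_)
    simp only [f]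
    ring
  have hca : ∀ᶠ ε in 𝓝[>] (0 : ℝ), ∀ i j j' l, dist (c ε i j) (a ε j' l) ≤ 1 ↔ j = j' := by
    simp only [eventually_all, c, a, hpt]
    intro i j j' l
    have := eventually_le_one_iff (sq_sub_half_ne_zero j j')
      ((f j - f i - f j') ^ 2 + 3 / 4 * (2 / 3 * (f j + f i) + 4 / 3 * (f l - f j' / 2)) ^ 2)
    simp only [sq_sub_half_neg_iff, Fin.val_inj] at this
    refine this.mono fun ε h => ?_
    rw [← h]
    refine iff_of_eq (congrArg (· ≤ 1) ?_)
    simp only [f]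
    ring
  have hxx : ∀ᶠ ε in 𝓝[>] (0 : ℝ), ∀ l s i j, dist (x ε l s i) (x ε l s j) ≤ 1 := by
    simp only [eventually_all, x, hpt]
    exact fun l s i j => eventually_le_one (by fun_prop) (by norm_num)
  have hxy : ∀ᶠ ε in 𝓝[>] (0 : ℝ), ∀ l i j, dist (x ε l true i) (x ε l false j) ≤ 1 ↔ i = j := by
    filter_upwards [hpos] with ε hε l i j
    simp only [x, hpt]
    -- Diameter and tangent are orthogonal, so Pythagoras gives the squared distance exactly,
    -- without passing to small `ε`.
    have e : (0 - 0 : ℝ) ^ 2 + 3 / 4 * (0 - 0) ^ 2 + (σ true * co l / 2 - i * ε * si l -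
        (σ false * co l / 2 - j * ε * si l)) ^ 2 + (σ true * si l / 2 + i * ε * co l -
        (σ false * si l / 2 + j * ε * co l)) ^ 2 + (0 - 0) ^ 2 = 1 + (ε * (i - j)) ^ 2 := by
      simp only [σ, if_true, Bool.false_eq_true, if_false]
      linear_combination (1 + (ε * (i - j)) ^ 2) * hcs l
    rw [e, ← Fin.val_inj, ← Nat.cast_inj (R := ℝ), ← sub_eq_zero]
    constructor
    · intro h
      have : (ε * ((i : ℝ) - j)) = 0 := by nlinarith [sq_nonneg (ε * ((i : ℝ) - j))]
      exact (mul_eq_zero.mp this).resolve_left hε.ne'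
    · intro h
      rw [h]; norm_num
  have hxm : ∀ᶠ ε in 𝓝[>] (0 : ℝ), ∀ l m s t i j, l ≠ m → dist (x ε l s i) (x ε m t j) ≤ 1 := by
    simp only [eventually_all, x, hpt]
    intro l m s t i j hlm
    refine eventually_le_one (by fun_prop) ?_
    have h1 := hcs l
    have h2 := hcs m
    obtain ⟨h3, h4⟩ := hlt l m (fun h => hlm (Fin.ext h))
    rcases s <;> rcases t <;> simp only [σ, if_true, Bool.false_eq_true, if_false] <;> nlinarith
  have hxa : ∀ᶠ ε in 𝓝[>] (0 : ℝ), ∀ l s t i j, dist (x ε l s t) (a ε i j) ≤ 1 := by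
    simp only [eventually_all, x, a, hpt]
    -- In the limit the two points lie in orthogonal subspaces at squared norms `1 / 4` and `1 / 3`,
    -- with sum less than `1`.
    exact fun l s t i j => eventually_le_one (by fun_prop) (by nlinarith [hcs l, hσ s])
  have hxb : ∀ᶠ ε in 𝓝[>] (0 : ℝ), ∀ l s t i j, dist (x ε l s t) (b ε i j) ≤ 1 := by
    simp only [eventually_all, x, b, hpt]
    exact fun l s t i j => eventually_le_one (by fun_prop) (by nlinarith [hcs l, hσ s])
  have hxc : ∀ᶠ ε in 𝓝[>] (0 : ℝ), ∀ l s t i j, dist (x ε l s t) (c ε i j) ≤ 1 := by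
    simp only [eventually_all, x, c, hpt]
    exact fun l s t i j => eventually_le_one (by fun_prop) (by nlinarith [hcs l, hσ s])
  obtain ⟨ε, h⟩ := (haa.and <| hbb.and <| hcc.and <| hab.and <| hbc.and <| hca.and <| hxx.and <|
    hxy.and <| hxm.and <| hxa.and <| hxb.and hxc).exists
  exact ⟨a ε, b ε, c ε, x ε, h⟩

end Rips

/-! ### Counting points and classes -/

namespace Rips

theorem FacetCycles.card_le_maxBetti {k : Type*} [Field k] {d : ℕ}
    {r : EuclideanSpace ℝ (Fin d) → EuclideanSpace ℝ (Fin d) → Prop} [IsStrictTotalOrder _ r]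
    {S : Finset (EuclideanSpace ℝ (Fin d))} {p n : ℕ} {ι : Type} [Fintype ι]
    (A : FacetCycles k r S (p + 1) ι) (hn : S.card ≤ n) : Fintype.card ι ≤ maxBetti k p d n :=
  A.card_le_reducedBetti.trans ((isGreatest_maxBetti k p d n).2 ⟨S, hn, rfl⟩)

/-- Induction on the number of ladders. The first conclusion, on where the points of `S'` come from,
is what shows that the next ladder is adjacent to everything built so far. -/
theorem FacetCycles.exists_joinLadders {k : Type*} [Field k] {E : Type*} [MetricSpace E]
    {r : E → E → Prop} [IsStrictTotalOrder E r] {S : Finset E} {m : ℕ} {ι : Type} [Fintype ι]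
    (A : FacetCycles k r S m ι) {L : ℕ} (q : ℕ) (x : Fin q → Bool → Fin (L + 1) → E)
    (hxx : ∀ l s i j, dist (x l s i) (x l s j) ≤ 1)
    (hxy : ∀ l i j, dist (x l true i) (x l false j) ≤ 1 ↔ i = j)
    (hxm : ∀ l m s t i j, l ≠ m → dist (x l s i) (x m t j) ≤ 1)
    (hxS : ∀ l s i, ∀ v ∈ S, dist (x l s i) v ≤ 1) :
    ∃ (S' : Finset E) (ι' : Type) (_ : Fintype ι') (_ : FacetCycles k r S' (m + 2 * q) ι'),
      (∀ v ∈ S', v ∈ S ∨ ∃ l s i, v = x l s i) ∧ S'.card ≤ S.card + q * (2 * (L + 1)) ∧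
      Fintype.card ι' = Fintype.card ι * L ^ q := by
  classical
  induction q with
  | zero => exact ⟨S, ι, inferInstance, A, fun v hv => Or.inl hv, by simp, by simp⟩
  | succ q ih =>
    obtain ⟨S', ι', _, A', hS', hcard, hι⟩ := ih (fun l => x l.castSucc) (fun l => hxx _)
      (fun l => hxy _)
      (fun l m s t i j h => hxm _ _ s t i j (fun h' => h (Fin.castSucc_injective _ h')))
      (fun l => hxS _)
    have hnear : ∀ s i, ∀ v ∈ S', dist (x (Fin.last q) s i) v ≤ 1 := by
      intro s i v hv
      rcases hS' v hv with h | ⟨l, t, j, rfl⟩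
      · exact hxS _ s i v h
      · exact hxm _ _ s t i j (Fin.castSucc_lt_last l).ne'
    refine ⟨_, ι' × Fin L, inferInstance, A'.joinLadder (x (Fin.last q) true)
      (x (Fin.last q) false) (hxx _ _) (hxx _ _) (hxy _) (hnear _) (hnear _), ?_, ?_, ?_⟩
    · intro v hv
      simp only [Finset.mem_union, Finset.mem_image, Finset.mem_univ, true_and] at hv
      rcases hv with (hv | ⟨i, rfl⟩) | ⟨i, rfl⟩
      · rcases hS' v hv with h | ⟨l, t, j, rfl⟩
        · exact Or.inl h
        · exact Or.inr ⟨_, _, _, rfl⟩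
      · exact Or.inr ⟨_, _, _, rfl⟩
      · exact Or.inr ⟨_, _, _, rfl⟩
    · refine (Finset.card_union_le _ _).trans ?_
      have h1 := Finset.card_union_le S' (Finset.univ.image (x (Fin.last q) true))
      have h2 := Finset.card_image_le (s := Finset.univ) (f := x (Fin.last q) true)
      have h3 := Finset.card_image_le (s := Finset.univ) (f := x (Fin.last q) false)
      rw [Finset.card_univ, Fintype.card_fin] at h2 h3
      linarith
    · rw [Fintype.card_prod, hι, Fintype.card_fin, pow_succ, mul_assoc]

theorem pow_le_maxBetti_odd {d : ℕ} (hd : 5 ≤ d) (q L : ℕ) (k : Type*) [Field k] :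
    L ^ (q + 1) ≤ maxBetti k (2 * q + 1) d ((q + 1) * (2 * (L + 1))) := by
  obtain ⟨-, -, -, x, -, -, -, -, -, -, hxx, hxy, hxm, -⟩ := exists_configuration hd (q + 1) L 0
  have : IsStrictTotalOrder (EuclideanSpace ℝ (Fin d)) WellOrderingRel := { }
  obtain ⟨S, ι, _, A, -, hS, hι⟩ := (FacetCycles.empty k WellOrderingRel).exists_joinLadders
    (q + 1) x hxx hxy hxm (by simp)
  rw [Fintype.card_unit, one_mul] at hι
  rw [← hι]
  have e : 0 + 2 * (q + 1) = (2 * q + 1) + 1 := by ring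
  exact (e ▸ A).card_le_maxBetti (by simpa using hS)

open Classical in
theorem card_image_union_image_union_image_le {V : Type*} {n : ℕ} (a b c : Fin n → Fin n → V) :
    (Finset.univ.image (Function.uncurry a) ∪ Finset.univ.image (Function.uncurry b)
      ∪ Finset.univ.image (Function.uncurry c)).card ≤ 3 * n ^ 2 := by
  have hc : ∀ g : Fin n → Fin n → V, (Finset.univ.image (Function.uncurry g)).card ≤ n ^ 2 :=
    fun g => Finset.card_image_le.trans
      (by rw [Finset.card_univ, Fintype.card_prod, Fintype.card_fin, sq])
  refine (Finset.card_union_le _ _).trans ?_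
  have h1 := Finset.card_union_le (Finset.univ.image (Function.uncurry a))
    (Finset.univ.image (Function.uncurry b))
  have h2 := hc a
  have h3 := hc b
  have h4 := hc c
  linarith

theorem pow_le_maxBetti_even {d : ℕ} (hd : 5 ≤ d) (q L N : ℕ) (k : Type*) [Field k] :
    N ^ 3 * L ^ q ≤ maxBetti k (2 * q + 2) d (3 * (N + 1) ^ 2 + q * (2 * (L + 1))) := by
  obtain ⟨a, b, c, x, haa, hbb, hcc, hab, hbc, hca, hxx, hxy, hxm, hxa, hxb, hxc⟩ :=
    exists_configuration hd q L N
  have : IsStrictTotalOrder (EuclideanSpace ℝ (Fin d)) WellOrderingRel := { }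
  obtain ⟨S, ι, _, A, -, hS, hι⟩ := (FacetCycles.grid k WellOrderingRel a b c haa hbb hcc hab hbc
    hca).exists_joinLadders q x hxx hxy hxm (by
      intro l s i v hv
      simp only [Finset.mem_union, Finset.mem_image, Finset.mem_univ, true_and, Prod.exists,
        Function.uncurry_apply_pair] at hv
      rcases hv with (⟨i, j, rfl⟩ | ⟨i, j, rfl⟩) | ⟨i, j, rfl⟩
      · exact hxa _ _ _ _ _
      · exact hxb _ _ _ _ _
      · exact hxc _ _ _ _ _)
  have hι' : Fintype.card ι = N ^ 3 * L ^ q := by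
    rw [hι, Fintype.card_prod, Fintype.card_prod, Fintype.card_fin]; ring
  rw [← hι']
  have e : 3 + 2 * q = (2 * q + 2) + 1 := by ring
  refine (e ▸ A).card_le_maxBetti (hS.trans (Nat.add_le_add_right ?_ _))
  exact card_image_union_image_union_image_le a b c

theorem maxBetti_mono (k : Type*) [Field k] (p d : ℕ) {m n : ℕ} (h : m ≤ n) :
    maxBetti k p d m ≤ maxBetti k p d n := by
  obtain ⟨S, hS, hb⟩ := (isGreatest_maxBetti k p d m).1
  exact (isGreatest_maxBetti k p d n).2 ⟨S, hS.trans h, hb⟩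

/-- Ladders of length `N ^ 2` balance the costs. The number of points stays within the budget since
`3 (N + 1) ^ 2 ≤ 12 N ^ 2` and each ladder has at most `4 N ^ 2` points. -/
theorem pow_succ_le_maxBetti {p : ℕ} (hp : 0 < p) {d : ℕ} (hd : 5 ≤ d) {N : ℕ} (hN : 1 ≤ N)
    (k : Type*) [Field k] : N ^ (p + 1) ≤ maxBetti k p d ((4 * p + 12) * N ^ 2) := by
  have hN2 : 1 ≤ N ^ 2 := Nat.one_le_pow _ _ hN
  obtain ⟨q, rfl | rfl⟩ : ∃ q, p = 2 * q + 1 ∨ p = 2 * q + 2 := by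
    obtain ⟨q, h | h⟩ := Nat.even_or_odd' (p - 1)
    · exact ⟨q, by omega⟩
    · exact ⟨q, by omega⟩
  · refine (le_of_eq ?_).trans ((pow_le_maxBetti_odd hd q (N ^ 2) k).trans (maxBetti_mono k _ d ?_))
    · rw [← pow_mul]; ring
    · nlinarith
  · refine (le_of_eq ?_).trans
      ((pow_le_maxBetti_even hd q (N ^ 2) N k).trans (maxBetti_mono k _ d ?_))
    · rw [← pow_mul, ← pow_add]; ring
    · nlinarith

end Rips

theorem mainTheorem7 (p : ℕ) (hp : 0 < p) :
    ∃ C : ℝ, 0 < C ∧ ∀ d : ℕ, 5 ≤ d → ∃ N : ℕ, ∀ n : ℕ, N ≤ n →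
      ∀ (k : Type*) [Field k],
        C * (n : ℝ) ^ ((p : ℝ) / 2 + 1 / 2) ≤ (Rips.maxBetti k p d n : ℝ) := by
  set K : ℕ := 4 * p + 12 with hK
  have hK0 : (0 : ℝ) < 4 * K := by positivity
  set s : ℝ := (p : ℝ) / 2 + 1 / 2 with hs
  -- Taking `N` as the integer square root of `n / K` gives `K N ^ 2 ≤ n ≤ 4 K N ^ 2`, and the
  -- factor `4 K` becomes the constant. The threshold `K` ensures `N ≥ 1`, hence `(N + 1) ^ 2 ≤ 4 N
  -- ^ 2`.
  refine ⟨((4 * K : ℝ) ^ s)⁻¹, by positivity, fun d hd => ⟨K, fun n hn k _ => ?_⟩⟩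
  set N := Nat.sqrt (n / K) with hN
  have hKpos : 0 < K := by omega
  have hN1 : 1 ≤ N := Nat.le_sqrt.mpr (by rw [one_mul]; exact Nat.div_pos hn hKpos)
  have hle : K * N ^ 2 ≤ n :=
    (Nat.mul_le_mul_left K (Nat.sqrt_le' _)).trans (Nat.mul_div_le n K)
  have hlt : n ≤ 4 * K * N ^ 2 := by
    have h1 : n / K < (N + 1) ^ 2 := Nat.lt_succ_sqrt' _
    have h2 : n < (N + 1) ^ 2 * K := (Nat.div_lt_iff_lt_mul hKpos).mp h1
    have h3 : (N + 1) ^ 2 ≤ 4 * N ^ 2 := by nlinarith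
    calc n ≤ (N + 1) ^ 2 * K := h2.le
      _ ≤ 4 * N ^ 2 * K := Nat.mul_le_mul_right K h3
      _ = 4 * K * N ^ 2 := by ring
  have hb : N ^ (p + 1) ≤ Rips.maxBetti k p d n :=
    (Rips.pow_succ_le_maxBetti hp hd hN1 k).trans (Rips.maxBetti_mono k p d hle)
  have hpow : ((N : ℝ) ^ 2) ^ s = (N : ℝ) ^ (p + 1) := by
    rw [← Real.rpow_natCast, ← Real.rpow_natCast, ← Real.rpow_mul (Nat.cast_nonneg N)]
    congr 1
    rw [hs]; push_cast; ring
  rw [inv_mul_le_iff₀ (by positivity)]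
  calc (n : ℝ) ^ s ≤ (4 * K * (N : ℝ) ^ 2) ^ s :=
        Real.rpow_le_rpow (Nat.cast_nonneg n) (by exact_mod_cast hlt) (by positivity)
    _ = (4 * K : ℝ) ^ s * (N : ℝ) ^ (p + 1) := by
        rw [Real.mul_rpow hK0.le (by positivity), hpow]
    _ ≤ (4 * K : ℝ) ^ s * Rips.maxBetti k p d n := by
        gcongr
        exact_mod_cast hb
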